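/- Let $K$ be a totally real number field and let $\mathcal O^+$ be the set of totally positive algebraic integers of $K$. A partition of $\delta\in\mathcal O^+$ is a finite sequence, up to order, of elements of $\mathcal O^+$ (its parts) with sum $\delta$. An element $\gamma\in\mathcal O^+$ is called primitive if $\gamma\notin n\mathcal O^+$ for every integer $n\ge2$. Every $\alpha\in\mathcal O^+$ can be written uniquely as $\alpha=s(\alpha)\,t(\alpha)$ with $s(\alpha)$ a positive rational integer (the scale of $\alpha$) and $t(\alpha)\in\mathcal O^+$ primitive (the primitive factor of $\alpha$). Let $k\ge2$ and $1\le i\le k$ be integers. Then for every $\delta\in\mathcal O^+$ the following two sets of partitions of $\delta$ are finite and have the same number of elements: (a) the partitions $\lambda=(\lambda_1,\dots,\lambda_r)$ of $\delta$ such that for each part $\lambda_a$ there are at most $k-1$ indices $j$ with $t(\lambda_j)=t(\lambda_a)$ and $s(\lambda_a)-s(\lambda_j)\in\{0,1\}$, and such that for each primitive $\gamma\in\mathcal O^+$ there are at most $i-1$ indices $j$ with $\lambda_j=\gamma$; (b) the partitions of $\delta$ none of whose parts has scale congruent to $0$, $i$ or $-i$ modulo $2k+1$. -/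

import Mathlib

open NumberField

namespace TotallyRealPartition

/-- An algebraic integer of `K` is totally positive if its image under every real embedding of `K`
is positive (when `K` is totally real, these are all the embeddings of `K`). -/
def IsTotallyPositive {K : Type*} [Field K] (δ : 𝓞 K) : Prop :=
  ∀ φ : K →+* ℝ, 0 < φ (δ : K)

/-- The set `𝒪⁺` of totally positive algebraic integers of `K`. -/
abbrev TotPos (K : Type*) [Field K] : Type _ := {δ : 𝓞 K // IsTotallyPositive δ}

/-- `γ ∈ 𝒪⁺` is primitive (over `ℚ`) if it is not in `n 𝒪⁺` for any positive rational integer `n`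
other than the unit `1`. -/
def IsPrimitive {K : Type*} [Field K] (γ : TotPos K) : Prop :=
  ∀ n : ℕ, 0 < n → n ≠ 1 → ¬ ∃ β : TotPos K, (γ : 𝓞 K) = n * (β : 𝓞 K)

/-- `δ = n γ` is a radial decomposition of `δ`: `n` is a positive rational integer and `γ` is a
primitive element of `𝒪⁺`. -/
def IsRadialDecomposition {K : Type*} [Field K] (δ : TotPos K) (n : ℕ) (γ : TotPos K) : Prop :=
  0 < n ∧ IsPrimitive γ ∧ (δ : 𝓞 K) = n * (γ : 𝓞 K)

theorem TotPos.ne_zero {K : Type*} [Field K] [NumberField K] [IsTotallyReal K] (δ : TotPos K) :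
    (δ : 𝓞 K) ≠ 0 := by
  intro h
  obtain ⟨v⟩ : Nonempty (InfinitePlace K) := inferInstance
  have := δ.2 (InfinitePlace.embedding_of_isReal (IsTotallyReal.isReal v))
  simp [h] at this

theorem isTotallyPositive_of_natCast_mul {K : Type*} [Field K] {β : 𝓞 K} {n : ℕ}
    (h : IsTotallyPositive ((n : 𝓞 K) * β)) : IsTotallyPositive β := by
  intro φ
  have h1 := h φ
  simp only [map_mul, map_natCast] at h1
  exact pos_of_mul_pos_right h1 (Nat.cast_nonneg n)

theorem exists_radial {K : Type*} [Field K] [NumberField K] [IsTotallyReal K] (δ : TotPos K) :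
    ∃ p : ℕ × TotPos K, IsRadialDecomposition δ p.1 p.2 := by
  classical
  let P : ℕ → Prop := fun n => ∃ β : TotPos K, (δ : 𝓞 K) = n * (β : 𝓞 K)
  have hδ := δ.ne_zero
  have bound : ∀ n, P n → n ≤ (Algebra.norm ℤ (δ : 𝓞 K)).natAbs := by
    rintro n ⟨β, hβ⟩
    have h0 : Algebra.norm ℤ (δ : 𝓞 K) ≠ 0 := by
      rw [Ne, Algebra.norm_eq_zero_iff]; exact hδ
    have h1 : Algebra.norm ℤ (δ : 𝓞 K)
        = (n : ℤ) ^ Module.finrank ℤ (𝓞 K) * Algebra.norm ℤ (β : 𝓞 K) := by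
      rw [hβ, map_mul]
      congr 1
      have := Algebra.norm_algebraMap_of_basis (RingOfIntegers.basis K) (n : ℤ)
      rw [map_natCast] at this
      rw [this, ← Module.finrank_eq_card_basis (RingOfIntegers.basis K)]
    have hr : Module.finrank ℤ (𝓞 K) ≠ 0 := Module.finrank_pos.ne'
    refine Nat.le_of_dvd (Int.natAbs_pos.mpr h0) ?_
    rw [h1, Int.natAbs_mul, Int.natAbs_pow, Int.natAbs_natCast]
    exact (dvd_pow_self n hr).mul_right _
  have hP1 : P 1 := ⟨δ, by simp⟩
  set B := (Algebra.norm ℤ (δ : 𝓞 K)).natAbs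
  have hg : P (Nat.findGreatest P B) := Nat.findGreatest_spec (bound 1 hP1) hP1
  have hg1 : 1 ≤ Nat.findGreatest P B := Nat.le_findGreatest (bound 1 hP1) hP1
  obtain ⟨γ, hγ⟩ := hg
  refine ⟨(Nat.findGreatest P B, γ), hg1, ?_, hγ⟩
  rintro m hm hm1 ⟨β, hβ⟩
  have hP : P (Nat.findGreatest P B * m) := ⟨β, by rw [hγ, hβ]; push_cast; ring⟩
  have := Nat.le_findGreatest (bound _ hP) hP
  have : 2 ≤ m := by omega
  nlinarith

/-- The scale `s(δ)`: the positive rational integer of the radial decomposition of `δ`. -/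
noncomputable def scale {K : Type*} [Field K] [NumberField K] [IsTotallyReal K]
    (δ : TotPos K) : ℕ := (Classical.choose (exists_radial δ)).1

/-- The primitive factor `t(δ)`: the primitive element of the radial decomposition of `δ`. -/
noncomputable def primitiveFactor {K : Type*} [Field K] [NumberField K] [IsTotallyReal K]
    (δ : TotPos K) : TotPos K := (Classical.choose (exists_radial δ)).2

theorem radial_spec {K : Type*} [Field K] [NumberField K] [IsTotallyReal K] (δ : TotPos K) :
    IsRadialDecomposition δ (scale δ) (primitiveFactor δ) :=
  Classical.choose_spec (exists_radial δ)

/-- The radial decomposition is unique, so the scale and the primitive factor do not depend on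
any choice. -/
theorem radial_unique {K : Type*} [Field K] [NumberField K] {δ : TotPos K}
    {n m : ℕ} {γ γ' : TotPos K} (h : IsRadialDecomposition δ n γ)
    (h' : IsRadialDecomposition δ m γ') : n = m ∧ γ = γ' := by
  obtain ⟨hn, hγ, e⟩ := h
  obtain ⟨hm, hγ', e'⟩ := h'
  obtain ⟨g, a, b, hg, hab, rfl, rfl⟩ := Nat.exists_coprime' (Nat.gcd_pos_of_pos_left m hn)
  have ha : 0 < a := Nat.pos_of_mul_pos_right hn
  have hb : 0 < b := Nat.pos_of_mul_pos_right hm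
  have hgK : (g : 𝓞 K) ≠ 0 := by exact_mod_cast hg.ne'
  have key : (a : 𝓞 K) * (γ : 𝓞 K) = b * (γ' : 𝓞 K) := by
    apply mul_left_cancel₀ hgK
    have := e.symm.trans e'
    push_cast at this
    linear_combination this
  obtain ⟨x, y, hxy⟩ := Nat.isCoprime_iff_coprime.mpr hab
  have hxy' : (x : 𝓞 K) * a + y * b = 1 := by exact_mod_cast congrArg (Int.cast : ℤ → 𝓞 K) hxy
  obtain ⟨w, hw⟩ : ∃ w : 𝓞 K, w = (x : 𝓞 K) * (γ' : 𝓞 K) + (y : 𝓞 K) * (γ : 𝓞 K) := ⟨_, rfl⟩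
  have e1 : (γ' : 𝓞 K) = a * w := by
    rw [hw]
    linear_combination -(γ' : 𝓞 K) * hxy' - (y : 𝓞 K) * key
  have e2 : (γ : 𝓞 K) = b * w := by
    rw [hw]
    linear_combination -(γ : 𝓞 K) * hxy' + (x : 𝓞 K) * key
  have hpos : IsTotallyPositive w := by
    apply isTotallyPositive_of_natCast_mul (n := a)
    rw [← e1]
    exact γ'.2
  have a1 : a = 1 := by
    by_contra hne
    exact hγ' a ha hne ⟨⟨_, hpos⟩, e1⟩
  have b1 : b = 1 := by
    by_contra hne
    exact hγ b hb hne ⟨⟨_, hpos⟩, e2⟩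
  subst a1 b1
  exact ⟨rfl, Subtype.ext (by simpa using key)⟩

/-- A partition of `δ ∈ 𝒪⁺`: a finite sequence, up to order, of elements of `𝒪⁺` with sum `δ`. -/
structure Partition {K : Type*} [Field K] (δ : TotPos K) where
  /-- the parts, with multiplicity -/
  parts : Multiset (TotPos K)
  sum_eq : (parts.map (fun a : TotPos K => (a : 𝓞 K))).sum = δ

open Classical in
/-- For each part `a` there are at most `k - 1` parts `b`, counted with multiplicity, such that
`t(b) = t(a)` and `s(a) - s(b)` is `0` or `1`; and every primitive element occurs at most `i - 1`
times as a part. -/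
def IsGordon {K : Type*} [Field K] [NumberField K] [IsTotallyReal K] (k i : ℕ) {δ : TotPos K}
    (l : Partition δ) : Prop :=
  (∀ a ∈ l.parts,
    l.parts.countP (fun b => primitiveFactor b = primitiveFactor a ∧
      ((scale a : ℤ) - scale b = 0 ∨ (scale a : ℤ) - scale b = 1)) ≤ k - 1) ∧
  ∀ γ : TotPos K, IsPrimitive γ → l.parts.count γ ≤ i - 1

/-- No part has scale congruent to `0`, `i` or `-i` modulo `2k + 1`. -/
def HasScalesAvoiding {K : Type*} [Field K] [NumberField K] [IsTotallyReal K] (k i : ℕ)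
    {δ : TotPos K} (l : Partition δ) : Prop :=
  ∀ a ∈ l.parts, ¬ ((scale a : ℤ) ≡ 0 [ZMOD 2 * k + 1]) ∧
    ¬ ((scale a : ℤ) ≡ i [ZMOD 2 * k + 1]) ∧ ¬ ((scale a : ℤ) ≡ -i [ZMOD 2 * k + 1])

end TotallyRealPartition

namespace RogersRamanujanGordon

open PowerSeries Finset

/-! A partition of `δ` is the same as a family of multisets of positive integers, one for each
primitive `γ`: the scales of its parts on the ray of `γ`. Conditions (a) and (b) both constrain
these multisets one ray at a time, and on each ray they are the two sides of Gordon's theorem. A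
sum-preserving bijection applied ray by ray does not change `δ`, so the theorem reduces to Gordon's
(`ncard_eq_of_scalesAt`, `ncard_gordonSet_eq_ncard_avoidingSet`).

Gordon's theorem is proved by Andrews' method. Write (x)_N for the product of 1 - x^m over 1 ≤ m ≤
N. Sorting by the multiplicity of the smallest allowed part gives a recurrence for the series of
`gordonSet k i j`. Andrews' series, multiplied by (x)_∞, satisfies the same recurrence up to a
telescoping term, and both sides agree for large j. At j = 0 it is a theta series, which the Jacobi
triple product turns into the product of 1 - x^m over m ≡ 0, ±i mod 2k+1. Dividing by (x)_∞ leaves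
the generating function of (b).

Infinite sums and products are mostly replaced by finite ones modulo x^N; a coefficient is read off
by taking N large. -/

/-! ### Gordon's multisets and their recurrence -/

theorem finite_multiset_sum_eq (n : ℕ) : {m : Multiset ℕ | m.sum = n ∧ ∀ a ∈ m, 0 < a}.Finite := by
  refine (Set.finite_range (fun p : n.Partition => p.parts)).subset ?_
  rintro m ⟨hm, hpos⟩
  exact ⟨⟨m, fun {a} ha => hpos a ha, hm⟩, rfl⟩

/-- Multisets with sum `n` and all elements greater than `j`, in which `j + 1` occurs fewer than
`i` times and any two consecutive integers occur fewer than `k` times together. -/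
def gordonSet (k i j n : ℕ) : Set (Multiset ℕ) :=
  {m | m.sum = n ∧ (∀ a ∈ m, j < a) ∧ m.count (j + 1) < i ∧
    ∀ s, m.count s + m.count (s + 1) < k}

theorem finite_gordonSet (k i j n : ℕ) : (gordonSet k i j n).Finite :=
  (finite_multiset_sum_eq n).subset fun _ h => ⟨h.1, fun a ha => (h.2.1 a ha).pos⟩

theorem gordonSet_zero (k j n : ℕ) : gordonSet k 0 j n = ∅ := by
  ext m; simp [gordonSet]

theorem count_eq_zero_of_lt {m : Multiset ℕ} {j a : ℕ} (h : ∀ b ∈ m, j < b) (ha : a ≤ j) :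
    m.count a = 0 :=
  Multiset.count_eq_zero.mpr fun hm => (h a hm).not_ge ha

theorem replicate_add_mem_gordonSet {k i j n : ℕ} (hi : i < k) {m : Multiset ℕ}
    (hm : m ∈ gordonSet k (k - i) (j + 1) n) :
    Multiset.replicate i (j + 1) + m ∈ gordonSet k (i + 1) j (n + (j + 1) * i) := by
  obtain ⟨h1, h2, h3, h4⟩ := hm
  have hz : ∀ a ≤ j + 1, m.count a = 0 := fun a ha => count_eq_zero_of_lt h2 ha
  refine ⟨?_, ?_, ?_, ?_⟩
  · simp [h1]; ring
  · intro a ha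
    rcases Multiset.mem_add.mp ha with h | h
    · rw [Multiset.eq_of_mem_replicate h]; omega
    · have := h2 a h; omega
  · rw [Multiset.count_add, hz _ le_rfl, Multiset.count_replicate_self]; omega
  · intro s
    have h4 := h4 s
    simp only [Multiset.count_add, Multiset.count_replicate]
    rcases lt_trichotomy s (j + 1) with h | rfl | h
    · rw [hz s h.le, hz (s + 1) h]
      split_ifs <;> omega
    · rw [hz _ le_rfl]
      split_ifs <;> omega
    · split_ifs <;> omega

theorem filter_mem_gordonSet {k i j n : ℕ} {m : Multiset ℕ}
    (hm : m ∈ gordonSet k (i + 1) j n) (hc : m.count (j + 1) = i) :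
    ∃ m' ∈ gordonSet k (k - i) (j + 1) (n - (j + 1) * i),
      (j + 1) * i ≤ n ∧ m = Multiset.replicate i (j + 1) + m' := by
  obtain ⟨h1, h2, h3, h4⟩ := hm
  have key : m = Multiset.replicate i (j + 1) + m.filter (fun a => ¬ a = j + 1) := by
    conv_lhs => rw [← Multiset.filter_add_not (fun a => a = j + 1) m, Multiset.filter_eq', hc]
  have hs := congrArg Multiset.sum key
  rw [Multiset.sum_add, h1, Multiset.sum_replicate, smul_eq_mul, mul_comm i] at hs
  refine ⟨_, ⟨?_, ?_, ?_, ?_⟩, ?_, key⟩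
  · omega
  · intro a ha
    rw [Multiset.mem_filter] at ha
    have := h2 a ha.1
    omega
  · rw [Multiset.count_filter_of_pos (by omega)]
    have := h4 (j + 1)
    omega
  · intro s
    have := h4 s
    have := Multiset.count_le_of_le s (Multiset.filter_le (fun a => ¬ a = j + 1) m)
    have := Multiset.count_le_of_le (s + 1) (Multiset.filter_le (fun a => ¬ a = j + 1) m)
    omega
  · omega

/-- Either `j + 1` occurs fewer than `i` times, or exactly `i` times. In the second case deleting
these copies leaves parts above `j + 1`, and the condition on consecutive integers allows `j + 2`
fewer than `k - i` times. -/
theorem ncard_gordonSet_succ {k i : ℕ} (hi : i < k) (j n : ℕ) :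
    (gordonSet k (i + 1) j n).ncard = (gordonSet k i j n).ncard +
      if (j + 1) * i ≤ n then (gordonSet k (k - i) (j + 1) (n - (j + 1) * i)).ncard else 0 := by
  have hsplit : gordonSet k (i + 1) j n =
      gordonSet k i j n ∪ {m ∈ gordonSet k (i + 1) j n | m.count (j + 1) = i} := by
    ext m
    simp only [gordonSet, Set.mem_ofPred_eq, Set.mem_union]
    constructor
    · rintro ⟨h1, h2, h3, h4⟩
      rcases Nat.lt_succ_iff_lt_or_eq.mp h3 with h | h
      · exact Or.inl ⟨h1, h2, h, h4⟩
      · exact Or.inr ⟨⟨h1, h2, h3, h4⟩, h⟩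
    · rintro (⟨h1, h2, h3, h4⟩ | ⟨h, -⟩)
      · exact ⟨h1, h2, by omega, h4⟩
      · exact h
  rw [hsplit, Set.ncard_union_eq ?_ (finite_gordonSet _ _ _ _)
    ((finite_gordonSet _ _ _ _).subset (Set.sep_subset _ _))]
  · congr 1
    split_ifs with h
    · rw [← Set.ncard_image_of_injective (gordonSet k (k - i) (j + 1) (n - (j + 1) * i))
        (add_right_injective (Multiset.replicate i (j + 1)))]
      congr 1
      ext m
      constructor
      · rintro ⟨hm, hc⟩
        obtain ⟨m', hm', -, rfl⟩ := filter_mem_gordonSet hm hc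
        exact ⟨m', hm', rfl⟩
      · rintro ⟨m', hm', rfl⟩
        have := replicate_add_mem_gordonSet hi hm'
        rw [Nat.sub_add_cancel h] at this
        refine ⟨this, ?_⟩
        simp [count_eq_zero_of_lt hm'.2.1 le_rfl]
    · rw [Set.ncard_eq_zero ((finite_gordonSet _ _ _ _).subset (Set.sep_subset _ _))]
      ext m
      simp only [Set.mem_sep_iff, Set.mem_empty_iff_false, iff_false]
      rintro ⟨hm, hc⟩
      obtain ⟨m', hm', h', -⟩ := filter_mem_gordonSet hm hc
      exact h h'
  · rw [Set.disjoint_left]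
    rintro m hm ⟨-, hc⟩
    exact hm.2.2.1.ne hc

/-- The generating function of `gordonSet k i j`. -/
noncomputable def gordonSeries (k i j : ℕ) : ℤ⟦X⟧ :=
  PowerSeries.mk fun n => ((gordonSet k i j n).ncard : ℤ)

theorem gordonSeries_zero (k j : ℕ) : gordonSeries k 0 j = 0 := by
  ext n; simp [gordonSeries, gordonSet_zero]

theorem gordonSeries_succ {k i : ℕ} (hi : i < k) (j : ℕ) :
    gordonSeries k (i + 1) j =
      gordonSeries k i j + X ^ ((j + 1) * i) * gordonSeries k (k - i) (j + 1) := by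
  ext n
  rw [map_add, coeff_X_pow_mul']
  simp only [gordonSeries, coeff_mk]
  rw [ncard_gordonSet_succ hi]
  push_cast
  rfl

/-- A nonempty multiset of integers above `j` has sum at least `j + 1`. This is the boundary
condition of the recurrence at large `j`. -/
theorem X_pow_dvd_gordonSeries_sub_one {k i : ℕ} (hk : 0 < k) (hi : 0 < i) (j : ℕ) :
    (X : ℤ⟦X⟧) ^ (j + 1) ∣ gordonSeries k i j - 1 := by
  rw [X_pow_dvd_iff]
  intro n hn
  rw [map_sub, gordonSeries, coeff_mk, coeff_one]
  split_ifs with h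
  · subst h
    have : gordonSet k i j 0 = {0} := by
      ext m
      constructor
      · rintro ⟨h1, h2, -, -⟩
        refine Multiset.eq_zero_of_forall_notMem fun a ha => ?_
        have := Multiset.le_sum_of_mem ha
        have := h2 a ha
        omega
      · rintro rfl
        simp [gordonSet, hi, hk]
    simp [this]
  · have : gordonSet k i j n = ∅ := by
      ext m
      simp only [Set.mem_empty_iff_false, iff_false]
      rintro ⟨h1, h2, -, -⟩
      obtain ⟨a, ha⟩ : ∃ a, a ∈ m :=
        Multiset.exists_mem_of_ne_zero fun h0 => by
        rw [h0, Multiset.sum_zero] at h1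
        exact h h1.symm
      have := Multiset.le_sum_of_mem ha
      have := h2 a ha
      omega
    simp [this]

/-! ### Andrews' series and its recurrence -/

section Recurrence

variable {R : Type*} [CommRing R]

/-- The summands of Andrews' series `J` at `x ^ j`, with `k = i + c`, cleared of
denominators. -/
def andrewsTerm (x : R) (i c j n : ℕ) : R :=
  (-1) ^ n * x ^ (j * (i + c) * n + (i + c) * n ^ 2 + (n + 1).choose 2 + c * n) *
    (1 - x ^ (i * (j + 2 * n + 1))) * ∏ m ∈ range j, (1 - x ^ (n + 1 + m))

/-- The part of `andrewsTerm` that telescopes in the recurrence. -/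
def andrewsAux (x : R) (i c j n : ℕ) : R :=
  (-1) ^ n * x ^ (j * (i + 1 + c) * n + (i + 1 + c) * n ^ 2 + (n + 1).choose 2 + c * n) *
    ((1 - x ^ n) * ∏ m ∈ range j, (1 - x ^ (n + 1 + m)))

/-- The recurrence of `gordonSeries_succ` holds termwise up to a difference of consecutive values of
`andrewsAux`. Once the products are aligned, what remains is a polynomial identity in powers of `x`.
-/
theorem andrewsTerm_sub (x : R) (i c j n : ℕ) :
    andrewsTerm x (i + 1) c j n - andrewsTerm x i (c + 1) j n =
      x ^ ((j + 1) * i) * andrewsTerm x (c + 1) i (j + 1) n +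
        (andrewsAux x i c j n - andrewsAux x i c j (n + 1)) := by
  have h1 : (1 - x ^ (n + 1)) * ∏ m ∈ range j, (1 - x ^ (n + 1 + 1 + m)) =
      ∏ m ∈ range (j + 1), (1 - x ^ (n + 1 + m)) := by
    rw [prod_range_succ', mul_comm]
    congr 1
    exact prod_congr rfl fun m _ => by rw [add_right_comm, ← add_assoc]
  have h2 : (n + 1 + 1).choose 2 = (n + 1).choose 2 + (n + 1) := by
    rw [Nat.choose_succ_succ' (n + 1) 1, Nat.choose_one_right, add_comm]
  rw [andrewsAux, andrewsAux, h1, h2]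
  simp only [andrewsTerm]
  rw [prod_range_succ]
  ring

theorem sum_andrewsTerm_succ (x : R) (i c j N : ℕ) :
    ∑ n ∈ range N, andrewsTerm x (i + 1) c j n =
      ∑ n ∈ range N, andrewsTerm x i (c + 1) j n +
      x ^ ((j + 1) * i) * ∑ n ∈ range N, andrewsTerm x (c + 1) i (j + 1) n -
        andrewsAux x i c j N := by
  have h := sum_congr (rfl : range N = range N) fun n _ => andrewsTerm_sub x i c j n
  rw [sum_sub_distrib, sum_add_distrib, sum_range_sub', ← mul_sum] at h
  have h0 : andrewsAux x i c j 0 = 0 := by simp [andrewsAux]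
  rw [h0] at h
  linear_combination h

theorem pow_dvd_andrewsAux (x : R) (i c j N : ℕ) : x ^ N ∣ andrewsAux x i c j N := by
  refine Dvd.dvd.mul_right (Dvd.dvd.mul_left (pow_dvd_pow x ?_) _) _
  nlinarith [Nat.zero_le ((i + c) * N ^ 2), Nat.zero_le (j * (i + 1 + c) * N),
    Nat.zero_le (c * N), Nat.zero_le ((N + 1).choose 2), Nat.le_self_pow two_ne_zero N]

theorem andrewsTerm_zero (x : R) (c j n : ℕ) : andrewsTerm x 0 c j n = 0 := by
  simp [andrewsTerm]

theorem pow_dvd_prod_range_sub (x : R) {N K : ℕ} (h : N ≤ K) :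
    x ^ (N + 1) ∣ ∏ m ∈ range K, (1 - x ^ (m + 1)) - ∏ m ∈ range N, (1 - x ^ (m + 1)) := by
  induction K, h using Nat.le_induction with
  | base => simp
  | succ K hK ih =>
    rw [prod_range_succ, mul_sub, mul_one, sub_right_comm]
    exact dvd_sub ih (Dvd.dvd.mul_left (pow_dvd_pow x (by omega)) _)

/-- For `j ≥ N` every term with index at least 1 carries a power of `x` at least `j`, and the term
of index 0 is (x)_j (1 - x^(i(j+1))). -/
theorem pow_dvd_sum_andrewsTerm_sub (x : R) {i c j N : ℕ} (hi : 0 < i) (hN : 0 < N) (hj : N ≤ j) :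
    x ^ N ∣ ∑ n ∈ range N, andrewsTerm x i c j n - ∏ m ∈ range N, (1 - x ^ (m + 1)) := by
  obtain ⟨N, rfl⟩ := Nat.exists_eq_add_one_of_ne_zero hN.ne'
  rw [sum_range_succ', add_sub_assoc]
  refine dvd_add (dvd_sum fun n _ => ?_) ?_
  · refine Dvd.dvd.mul_right (Dvd.dvd.mul_right (Dvd.dvd.mul_left (pow_dvd_pow x ?_) _) _) _
    have : j * 1 * 1 ≤ j * (i + c) * (n + 1) := by gcongr <;> omega
    omega
  · have h0 : andrewsTerm x i c j 0 = (1 - x ^ (i * (j + 1))) * ∏ m ∈ range j, (1 - x ^ (m + 1)) := by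
      simp [andrewsTerm, add_comm 1]
    rw [h0, sub_mul, one_mul, sub_right_comm]
    refine dvd_sub ((pow_dvd_pow x (by omega)).trans (pow_dvd_prod_range_sub x hj))
      (Dvd.dvd.mul_right (pow_dvd_pow x ?_) _)
    nlinarith

end Recurrence

/-- The recurrence either lowers `i` or raises `j`, so it determines everything from `i = 0` and `j
≥ N`. Hence the outer induction on `d`, which bounds the distance from `j` to `N`, and the inner one
on `i`. -/
theorem X_pow_dvd_prod_mul_gordonSeries_sub (N : ℕ) (hN : 0 < N) {k : ℕ} (d : ℕ) :
    ∀ i c j : ℕ, i + c = k → N ≤ j + d → (X : ℤ⟦X⟧) ^ N ∣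
      (∏ m ∈ range N, (1 - X ^ (m + 1))) * gordonSeries k i j -
        ∑ n ∈ range N, andrewsTerm X i c j n := by
  induction d with
  | zero =>
    intro i c j hk hj
    rw [add_zero] at hj
    rcases Nat.eq_zero_or_pos i with rfl | hi
    · simp [gordonSeries_zero, andrewsTerm_zero]
    · have h1 := pow_dvd_sum_andrewsTerm_sub (X : ℤ⟦X⟧) (c := c) hi hN hj
      have h2 := (pow_dvd_pow (X : ℤ⟦X⟧) (by omega : N ≤ j + 1)).trans
        (X_pow_dvd_gordonSeries_sub_one (k := k) (by omega) hi j)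
      convert dvd_sub (h2.mul_left (∏ m ∈ range N, (1 - X ^ (m + 1)))) h1 using 1
      ring
  | succ d ih =>
    intro i
    induction i with
    | zero => intro c j hk hj; simp [gordonSeries_zero, andrewsTerm_zero]
    | succ i ihi =>
      intro c j hk hj
      have h1 := ihi (c + 1) j (by omega) hj
      have h2 := ih (c + 1) i (j + 1) (by omega) (by omega)
      rw [sum_andrewsTerm_succ, gordonSeries_succ (by omega), (by omega : k - i = c + 1)]
      have h3 := pow_dvd_andrewsAux (X : ℤ⟦X⟧) i c j N
      have := dvd_add (dvd_add h1 (h2.mul_left (X ^ ((j + 1) * i)))) h3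
      convert this using 1
      ring

/-! ### Gaussian binomials and the Jacobi triple product -/

section TripleProduct

variable {R : Type*} [CommRing R]

/-- The Gaussian binomial coefficients in base `p`. -/
def gaussBinom (p : R) : ℕ → ℕ → R
  | _, 0 => 1
  | 0, _ + 1 => 0
  | n + 1, k + 1 => gaussBinom p n k + p ^ (k + 1) * gaussBinom p n (k + 1)

@[simp]
theorem gaussBinom_zero_right (p : R) (n : ℕ) : gaussBinom p n 0 = 1 := by
  cases n <;> rfl

theorem gaussBinom_succ_succ (p : R) (n k : ℕ) : gaussBinom p (n + 1) (k + 1) =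
    gaussBinom p n k + p ^ (k + 1) * gaussBinom p n (k + 1) := rfl

theorem gaussBinom_eq_zero_of_lt (p : R) {n k : ℕ} (h : n < k) : gaussBinom p n k = 0 := by
  induction n generalizing k with
  | zero => obtain ⟨k, rfl⟩ := Nat.exists_eq_add_one_of_ne_zero h.ne'; rfl
  | succ n ih =>
    obtain ⟨k, rfl⟩ := Nat.exists_eq_add_one_of_ne_zero (Nat.ne_zero_of_lt h)
    rw [gaussBinom_succ_succ, ih (by omega), ih (by omega)]
    simp

theorem gaussBinom_self (p : R) (n : ℕ) : gaussBinom p n n = 1 := by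
  induction n with
  | zero => rfl
  | succ n ih => rw [gaussBinom_succ_succ, ih, gaussBinom_eq_zero_of_lt p (Nat.lt_succ_self n)]; simp

/-- The quotient formula for Gaussian binomials in division-free form; the induction on `k + l`
combines both terms of the Pascal rule. -/
theorem gaussBinom_mul_prod_mul_prod (p : R) (k l : ℕ) :
    gaussBinom p (k + l) k * (∏ m ∈ range k, (1 - p ^ (m + 1))) *
      (∏ m ∈ range l, (1 - p ^ (m + 1))) = ∏ m ∈ range (k + l), (1 - p ^ (m + 1)) := by
  induction h : k + l generalizing k l with
  | zero =>
    obtain ⟨rfl, rfl⟩ : k = 0 ∧ l = 0 := by omega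
    simp
  | succ n ih =>
    rcases k with _ | k
    · obtain rfl : l = n + 1 := by omega
      simp
    rcases l with _ | l
    · obtain rfl : k = n := by omega
      simp [gaussBinom_self]
    · have h1 := ih k (l + 1) (by omega)
      have h2 := ih (k + 1) l (by omega)
      rw [gaussBinom_succ_succ]
      have e : n + 1 = (k + 1) + (l + 1) := by omega
      rw [prod_range_succ _ n, e, pow_add]
      rw [prod_range_succ _ l] at h1 ⊢
      rw [prod_range_succ _ k] at h2 ⊢
      linear_combination (1 - p ^ (k + 1)) * h1 + p ^ (k + 1) * (1 - p ^ (l + 1)) * h2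

/-- The finite `q`-binomial theorem. -/
theorem prod_add_mul_pow_eq_sum_gaussBinom (p x y : R) (n : ℕ) :
    ∏ m ∈ range n, (y + x * p ^ m) =
      ∑ k ∈ range (n + 1), p ^ k.choose 2 * gaussBinom p n k * x ^ k * y ^ (n - k) := by
  induction n generalizing x with
  | zero => simp
  | succ n ih =>
    have h1 : ∏ m ∈ range n, (y + x * p ^ (m + 1)) = ∏ m ∈ range n, (y + (x * p) * p ^ m) :=
      prod_congr rfl fun m _ => by ring
    have hc (k : ℕ) : (k + 1).choose 2 = k.choose 2 + k := by
      rw [Nat.choose_succ_succ' k 1, Nat.choose_one_right, add_comm]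
    have h2 : (∑ k ∈ range (n + 1), p ^ k.choose 2 * gaussBinom p n k * (x * p) ^ k * y ^ (n - k))
        * y = ∑ k ∈ range (n + 1),
          p ^ (k + 1 + 1).choose 2 * gaussBinom p n (k + 1) * x ^ (k + 1) * y ^ (n - k) +
            y ^ (n + 1) := by
      -- The added top term vanishes because `gaussBinom p n (n + 1) = 0`; this permits the index
      -- shift.
      have h3 : ∑ k ∈ range (n + 2),
          p ^ (k + 1).choose 2 * gaussBinom p n k * x ^ k * y ^ (n + 1 - k) =
          ∑ k ∈ range (n + 1),
          p ^ (k + 1).choose 2 * gaussBinom p n k * x ^ k * y ^ (n + 1 - k) := by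
        rw [sum_range_succ _ (n + 1), gaussBinom_eq_zero_of_lt p (Nat.lt_succ_self n)]
        simp
      rw [sum_range_succ'] at h3
      simp only [Nat.add_sub_add_right] at h3
      rw [sum_mul]
      refine Eq.trans (sum_congr rfl fun k hk => ?_) (h3.symm.trans (by simp))
      have : n + 1 - k = n - k + 1 := by have := mem_range.mp hk; omega
      rw [hc, this]
      ring
    rw [prod_range_succ', h1, ih, sum_range_succ' _ (n + 1), pow_zero, mul_one, mul_add, h2,
      add_right_comm, sum_mul, ← sum_add_distrib]
    congr 1
    · refine sum_congr rfl fun k _ => ?_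
      rw [gaussBinom_succ_succ, Nat.add_sub_add_right, hc (k + 1), hc k]
      ring
    · simp

theorem two_mul_choose_two_add (a : ℕ) : 2 * a.choose 2 + a = a * a := by
  induction a with
  | zero => rfl
  | succ a ih =>
    rw [Nat.choose_succ_succ' a 1, Nat.choose_one_right]
    linarith

/-- A finite form of the Jacobi triple product identity. -/
theorem prod_one_sub_mul_one_sub_eq_sum [IsDomain R] {z w : R} (hz : z ≠ 0) (hw : w ≠ 0)
    (N : ℕ) :
    ∏ m ∈ range N, ((1 - z * (z * w) ^ m) * (1 - w * (z * w) ^ m)) =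
      ∑ n ∈ range N, gaussBinom (z * w) (2 * N) (N - n) *
        ((-1) ^ n * z ^ n.choose 2 * w ^ (n + 1).choose 2) +
      ∑ n ∈ range N, gaussBinom (z * w) (2 * N) (N + (n + 1)) *
        ((-1) ^ (n + 1) * z ^ (n + 2).choose 2 * w ^ (n + 1).choose 2) +
      (-1) ^ N * z ^ N.choose 2 * w ^ (N + 1).choose 2 := by
  -- Take the binomial theorem with `2 * N` factors (zw)^N - z(zw)^m. The upper half yields (zw)^N
  -- (1 - z(zw)^(m-N)), the lower half -z(zw)^m (1 - w(zw)^(N-1-m)). The monomials pulled out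
  -- multiply to this factor.
  have hK : (z * w) ^ (N * N) * (-z) ^ N * (z * w) ^ N.choose 2 ≠ 0 := by
    simp [hz, hw]
  apply mul_left_cancel₀ hK
  -- Terms below and above the middle index `N` are matched by comparing the exponents of `z` and
  -- `w` separately, using 2·C(a,2) + a = a².
  have hlow (n r : ℕ) (hN : N = n + r) :
      (z * w) ^ r.choose 2 * (-z) ^ r * ((z * w) ^ N) ^ (2 * N - r) =
      (z * w) ^ (N * N) * (-z) ^ N * (z * w) ^ N.choose 2 *
        ((-1) ^ n * z ^ n.choose 2 * w ^ (n + 1).choose 2) := by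
    have e : 2 * N - r = 2 * n + r := by omega
    have s : ((-1 : R) ^ n) * (-1) ^ n = 1 := by rw [← mul_pow]; simp
    have a1 := two_mul_choose_two_add r
    have a2 := two_mul_choose_two_add (n + r)
    have a3 := two_mul_choose_two_add n
    have a4 := two_mul_choose_two_add (n + 1)
    have ez : r.choose 2 + (r + (n + r) * (2 * n + r)) =
        (n + r) * (n + r) + ((n + r) + ((n + r).choose 2 + n.choose 2)) := by linarith
    have ew : r.choose 2 + (n + r) * (2 * n + r) =
        (n + r) * (n + r) + ((n + r).choose 2 + (n + 1).choose 2) := by linarith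
    rw [e, hN, neg_pow z r, neg_pow z (n + r), ← pow_mul]
    calc _ = (-1) ^ r * z ^ (r.choose 2 + (r + (n + r) * (2 * n + r))) *
          w ^ (r.choose 2 + (n + r) * (2 * n + r)) := by
          simp only [mul_pow, pow_add z, pow_add w]; ring
      _ = ((-1) ^ n * (-1) ^ n) * (-1) ^ r *
          z ^ ((n + r) * (n + r) + ((n + r) + ((n + r).choose 2 + n.choose 2))) *
          w ^ ((n + r) * (n + r) + ((n + r).choose 2 + (n + 1).choose 2)) := by
          rw [ez, ew, s, one_mul]
      _ = _ := by
          simp only [mul_pow, pow_add z, pow_add w, pow_add (-1 : R)]; ring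
  have hhigh (n r : ℕ) (hN : N = n + 1 + r) :
      (z * w) ^ (N + (n + 1)).choose 2 * (-z) ^ (N + (n + 1)) *
        ((z * w) ^ N) ^ (2 * N - (N + (n + 1))) =
      (z * w) ^ (N * N) * (-z) ^ N * (z * w) ^ N.choose 2 *
        ((-1) ^ (n + 1) * z ^ (n + 2).choose 2 * w ^ (n + 1).choose 2) := by
    have e : 2 * N - (N + (n + 1)) = r := by omega
    have a1 := two_mul_choose_two_add (N + (n + 1))
    have a2 := two_mul_choose_two_add N
    have a3 := two_mul_choose_two_add (n + 2)
    have a4 := two_mul_choose_two_add (n + 1)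
    have ez : (N + (n + 1)).choose 2 + ((N + (n + 1)) + N * r) =
        N * N + (N + (N.choose 2 + (n + 2).choose 2)) := by subst hN; linarith
    have ew : (N + (n + 1)).choose 2 + N * r =
        N * N + (N.choose 2 + (n + 1).choose 2) := by subst hN; linarith
    rw [e, neg_pow z (N + (n + 1)), neg_pow z N, ← pow_mul]
    calc _ = (-1) ^ (N + (n + 1)) * z ^ ((N + (n + 1)).choose 2 + ((N + (n + 1)) + N * r)) *
          w ^ ((N + (n + 1)).choose 2 + N * r) := by
          simp only [mul_pow, pow_add z, pow_add w]; ring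
      _ = _ := by
          rw [ez, ew]
          simp only [mul_pow, pow_add z, pow_add w, pow_add (-1 : R)]; ring
  have hprod : (z * w) ^ (N * N) * (-z) ^ N * (z * w) ^ N.choose 2 *
      ∏ m ∈ range N, ((1 - z * (z * w) ^ m) * (1 - w * (z * w) ^ m)) =
      ∏ m ∈ range (N + N), ((z * w) ^ N + -z * (z * w) ^ m) := by
    rw [prod_range_add, prod_mul_distrib]
    have h1 : ∏ m ∈ range N, ((z * w) ^ N + -z * (z * w) ^ (N + m)) =
        (z * w) ^ (N * N) * ∏ m ∈ range N, (1 - z * (z * w) ^ m) := by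
      have h3 : (z * w) ^ (N * N) = ∏ _m ∈ range N, (z * w) ^ N := by simp [pow_mul]
      rw [h3, ← prod_mul_distrib]
      exact prod_congr rfl fun m _ => by ring
    have h2 : ∏ m ∈ range N, ((z * w) ^ N + -z * (z * w) ^ m) =
        (-z) ^ N * (z * w) ^ N.choose 2 * ∏ m ∈ range N, (1 - w * (z * w) ^ m) := by
      have h3 : (-z) ^ N = ∏ _m ∈ range N, (-z) := by simp
      have h4 : (z * w) ^ N.choose 2 = ∏ m ∈ range N, (z * w) ^ m := by
        rw [prod_pow_eq_pow_sum, sum_range_id, Nat.choose_two_right]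
      rw [h3, h4, ← prod_range_reflect (fun m => 1 - w * (z * w) ^ m), ← prod_mul_distrib,
        ← prod_mul_distrib]
      refine prod_congr rfl fun m hm => ?_
      have : N = m + (N - 1 - m) + 1 := by have := mem_range.mp hm; omega
      nth_rewrite 1 [this]
      ring
    rw [h1, h2]
    ring
  rw [hprod, prod_add_mul_pow_eq_sum_gaussBinom, sum_range_succ', sum_range_add, ← two_mul,
    ← sum_range_reflect, mul_add, mul_add, mul_sum, mul_sum]
  congr 1
  · congr 1
    · refine sum_congr rfl fun n hn => ?_
      have hn := mem_range.mp hn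
      rw [(by omega : N - 1 - n + 1 = N - n)]
      linear_combination gaussBinom (z * w) (2 * N) (N - n) * hlow n (N - n) (by omega)
    · refine sum_congr rfl fun n hn => ?_
      have hn := mem_range.mp hn
      rw [add_assoc]
      linear_combination
        gaussBinom (z * w) (2 * N) (N + (n + 1)) * hhigh n (N - (n + 1)) (by omega)
  · rw [← hlow N 0 rfl]
    simp

/-- In `gaussBinom_mul_prod_mul_prod` the products of lengths `k`, `l`, `2 * N`, as well as the one
of length `N`, are all congruent to the product of length `r`, which is a unit and cancels. -/
theorem pow_dvd_prod_mul_gaussBinom_sub_one {p : R} (hp : ∀ n, IsUnit (1 - p ^ (n + 1)))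
    {N k l r : ℕ} (h : k + l = 2 * N) (hk : r ≤ k) (hl : r ≤ l) :
    p ^ (r + 1) ∣ (∏ m ∈ range N, (1 - p ^ (m + 1))) * gaussBinom p (2 * N) k - 1 := by
  have hA : IsUnit (∏ m ∈ range r, (1 - p ^ (m + 1))) :=
    (IsUnit.prod_iff).mpr fun m _ => hp m
  have key := gaussBinom_mul_prod_mul_prod p k l
  rw [h] at key
  obtain ⟨a, ha⟩ := pow_dvd_prod_range_sub p hk
  obtain ⟨b, hb⟩ := pow_dvd_prod_range_sub p hl
  obtain ⟨c, hc⟩ := pow_dvd_prod_range_sub p (by omega : r ≤ 2 * N)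
  obtain ⟨d, hd⟩ := pow_dvd_prod_range_sub p (by omega : r ≤ N)
  rw [sub_eq_iff_eq_add] at ha hb hc hd
  rw [ha, hb, hc] at key
  rw [hd]
  generalize gaussBinom p (2 * N) k = g at *
  generalize ∏ m ∈ range r, (1 - p ^ (m + 1)) = A at *
  rw [← hA.dvd_mul_left]
  refine ⟨c + A * d * g - g * (a * A + b * A + p ^ (r + 1) * a * b), ?_⟩
  linear_combination key

theorem le_choose_two_succ (n : ℕ) : n ≤ (n + 1).choose 2 := by
  rw [Nat.choose_succ_succ' n 1, Nat.choose_one_right]; omega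

/-- The Jacobi triple product identity, truncated modulo `x ^ N`. -/
theorem pow_dvd_tripleProduct_sub [IsDomain R] {x z w : R} (hz : z ≠ 0) (hw : w ≠ 0)
    (hu : ∀ n, IsUnit (1 - (z * w) ^ (n + 1))) (hxz : x ∣ z) (hxw : x ∣ w) (N : ℕ) :
    x ^ N ∣ ∏ m ∈ range N, ((1 - (z * w) ^ (m + 1)) *
        ((1 - z * (z * w) ^ m) * (1 - w * (z * w) ^ m))) -
      ∑ n ∈ range N, (-1) ^ n * z ^ n.choose 2 * w ^ (n + 1).choose 2 * (1 - z ^ (2 * n + 1)) := by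
  have hp : x ^ N ∣ (z * w) ^ N := pow_dvd_pow_of_dvd (hxz.mul_right w) N
  have hc (n : ℕ) : (n + 2).choose 2 = n.choose 2 + (2 * n + 1) := by
    have := two_mul_choose_two_add n
    have := two_mul_choose_two_add (n + 2)
    linarith
  rw [prod_mul_distrib, prod_one_sub_mul_one_sub_eq_sum hz hw, mul_add, mul_add, mul_sum, mul_sum]
  have hsum : ∑ n ∈ range N, (-1) ^ n * z ^ n.choose 2 * w ^ (n + 1).choose 2 *
      (1 - z ^ (2 * n + 1)) =
      ∑ n ∈ range N, (-1) ^ n * z ^ n.choose 2 * w ^ (n + 1).choose 2 +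
      ∑ n ∈ range N, (-1) ^ (n + 1) * z ^ (n + 2).choose 2 * w ^ (n + 1).choose 2 := by
    rw [← sum_add_distrib]
    refine sum_congr rfl fun n _ => ?_
    rw [hc]
    ring
  rw [hsum, add_sub_right_comm, add_sub_add_comm, ← sum_sub_distrib, ← sum_sub_distrib]
  refine dvd_add (dvd_add (dvd_sum fun n hn => hp.trans ?_) (dvd_sum fun n hn => hp.trans ?_)) ?_
  · have hn := mem_range.mp hn
    have h1 := pow_dvd_prod_mul_gaussBinom_sub_one hu (N := N) (k := N - n) (l := N + n)
      (r := N - n) (by omega) le_rfl (by omega)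
    have h2 : (z * w) ^ n.choose 2 ∣ (-1) ^ n * z ^ n.choose 2 * w ^ (n + 1).choose 2 := by
      rw [mul_pow, mul_assoc]
      refine Dvd.dvd.mul_left (mul_dvd_mul_left _ (pow_dvd_pow w ?_)) _
      exact Nat.choose_le_choose 2 (Nat.le_succ n)
    have h3 := mul_dvd_mul h1 h2
    rw [← pow_add] at h3
    -- The binomial is accurate only to order N - n + 1; the monomial supplies the missing C(n,2) ≥
    -- n - 1.
    refine ((pow_dvd_pow (z * w) ?_).trans h3).trans (dvd_of_eq (by ring))
    rcases n with _ | n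
    · omega
    · have := le_choose_two_succ n
      omega
  · have hn := mem_range.mp hn
    have h1 := pow_dvd_prod_mul_gaussBinom_sub_one hu (N := N) (k := N + (n + 1))
      (l := N - (n + 1)) (r := N - (n + 1)) (by omega) (by omega) le_rfl
    have h2 : (z * w) ^ (n + 1).choose 2 ∣
        (-1) ^ (n + 1) * z ^ (n + 2).choose 2 * w ^ (n + 1).choose 2 := by
      rw [mul_pow]
      refine mul_dvd_mul (Dvd.dvd.mul_left (pow_dvd_pow z ?_) _) dvd_rfl
      exact Nat.choose_le_choose 2 (Nat.le_succ _)
    have h3 := mul_dvd_mul h1 h2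
    rw [← pow_add] at h3
    refine ((pow_dvd_pow (z * w) ?_).trans h3).trans (dvd_of_eq (by ring))
    have := le_choose_two_succ n
    omega
  · refine Dvd.dvd.mul_left (Dvd.dvd.mul_left ?_ _) _
    exact (pow_dvd_pow_of_dvd hxw N).trans (pow_dvd_pow w (le_choose_two_succ N))

end TripleProduct

/-! ### The product side and Gordon's theorem -/

section Restricted

open scoped PowerSeries.WithPiTopology

/-- The first `K` factors of Euler's product cancel against the finite product, and all later
factors are 1 modulo X^N. -/
theorem X_pow_dvd_restricted_mul_prod_sub_one (p : ℕ → Prop) [DecidablePred p] {N K : ℕ}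
    (h : N ≤ K) :
    (X : ℤ⟦X⟧) ^ N ∣ (PowerSeries.mk fun n => (#(Nat.Partition.restricted n p) : ℤ)) *
      (∏ m ∈ range K, if p (m + 1) then 1 - X ^ (m + 1) else 1) - 1 := by
  set C : ℤ⟦X⟧ := PowerSeries.mk fun n => (#(Nat.Partition.restricted n p) : ℤ)
  set f : ℕ → ℤ⟦X⟧ := fun i => if p (i + 1) then ∑' j : ℕ, X ^ ((i + 1) * j) else 1
  set g : ℕ → ℤ⟦X⟧ := fun i => if p (i + 1) then 1 - X ^ (i + 1) else 1
  have hC : HasProd f C := Nat.Partition.hasProd_powerSeriesMk_card_restricted ℤ p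
  have hfg (i : ℕ) : f i * g i = 1 := by
    simp only [f, g]
    split_ifs
    · simp_rw [pow_mul]
      exact WithPiTopology.tsum_pow_mul_one_sub_of_constantCoeff_eq_zero (by simp)
    · simp
  have hf (i : ℕ) : (X : ℤ⟦X⟧) ^ (i + 1) ∣ f i - 1 := by
    have := hfg i
    simp only [g] at this
    split_ifs at this with hp
    · exact ⟨f i, by linear_combination this⟩
    · rw [mul_one] at this
      simp [this]
  rw [X_pow_dvd_iff]
  intro d hd
  rw [map_sub, sub_eq_zero]
  have hlim : Filter.Tendsto (fun s : Finset ℕ => coeff d ((∏ i ∈ s, f i) * ∏ m ∈ range K, g m))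
      Filter.atTop (nhds (coeff d (C * ∏ m ∈ range K, g m))) :=
    ((WithPiTopology.continuous_coeff ℤ d).tendsto _).comp (Filter.Tendsto.mul_const _ hC)
  -- The coefficient is constant along all finite index sets containing `range K`, so the limit
  -- equals that constant.
  refine tendsto_nhds_unique hlim (tendsto_const_nhds.congr' ?_)
  filter_upwards [Filter.eventually_ge_atTop (range K)] with s hs
  rw [← prod_sdiff hs, mul_assoc, ← prod_mul_distrib, prod_congr rfl fun i _ => hfg i, prod_const_one,
    mul_one]
  have : (X : ℤ⟦X⟧) ^ N ∣ ∏ i ∈ s \ range K, f i - 1 := by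
    refine prod_induction _ (fun a => (X : ℤ⟦X⟧) ^ N ∣ a - 1) ?_ (by simp) ?_
    · intro a b ha hb
      have := dvd_add (ha.mul_right b) hb
      convert this using 1
      ring
    · intro i hi
      have := (mem_sdiff.mp hi).2
      rw [mem_range] at this
      exact (pow_dvd_pow X (by omega)).trans (hf i)
  have h0 := (X_pow_dvd_iff.mp this) d hd
  rw [map_sub, sub_eq_zero] at h0
  exact h0.symm

end Restricted

/-- `a` is congruent to none of `0`, `i`, `-i` modulo `2 * k + 1`. -/
def AvoidsResidues (k i : ℕ) (a : ℕ) : Prop :=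
  ¬ ((a : ℤ) ≡ 0 [ZMOD 2 * k + 1]) ∧ ¬ ((a : ℤ) ≡ i [ZMOD 2 * k + 1]) ∧
    ¬ ((a : ℤ) ≡ -i [ZMOD 2 * k + 1])

instance (k i : ℕ) : DecidablePred (AvoidsResidues k i) := fun _ =>
  inferInstanceAs (Decidable (_ ∧ _ ∧ _))

theorem not_avoidsResidues_iff {i c : ℕ} (hi : 0 < i) (m r : ℕ) (hr : r < 2 * (i + c) + 1) :
    ¬ AvoidsResidues (i + c) i ((2 * (i + c) + 1) * m + r + 1) ↔
      r = 2 * (i + c) ∨ r = i - 1 ∨ r = 2 * (i + c) - i := by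
  have hcast : (((2 * (i + c) + 1) * m + r + 1 : ℕ) : ℤ) =
      (r + 1 : ℤ) + (2 * ((i + c : ℕ) : ℤ) + 1) * m := by push_cast; ring
  have hM : ((2 * (i + c) + 1 : ℕ) : ℤ) = 2 * ((i + c : ℕ) : ℤ) + 1 := by push_cast; ring
  have key (b : ℤ) : (((2 * (i + c) + 1) * m + r + 1 : ℕ) : ℤ) ≡ b [ZMOD 2 * ((i + c : ℕ) : ℤ) + 1] ↔
      (2 * ((i + c : ℕ) : ℤ) + 1) ∣ b - (r + 1) := by
    rw [hcast, Int.modEq_iff_dvd, ← sub_sub, dvd_sub_left (Dvd.intro _ rfl)]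
  have small (b : ℤ) (h1 : -(2 * ((i + c : ℕ) : ℤ) + 1) < b) (h2 : b < 2 * ((i + c : ℕ) : ℤ) + 1) :
      (2 * ((i + c : ℕ) : ℤ) + 1) ∣ b ↔ b = 0 :=
    ⟨fun h => Int.eq_zero_of_abs_lt_dvd h (abs_lt.mpr ⟨h1, h2⟩), by rintro rfl; simp⟩
  unfold AvoidsResidues
  -- Adding the modulus in the cases 0 and -i brings each difference strictly between -(2k+1) and
  -- 2k+1, where divisibility means vanishing.
  rw [key, key, key, ← dvd_add_self_right (b := (0 : ℤ) - (r + 1)),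
    ← dvd_add_self_right (b := -(i : ℤ) - (r + 1)), small _ (by omega) (by omega),
    small _ (by omega) (by omega), small _ (by omega) (by omega)]
  omega

/-- Each block of 2k+1 consecutive integers contributes exactly three factors. The residues 0, i, -i
are distinct, since 0 < i ≤ k. -/
theorem prod_not_avoidsResidues {R : Type*} [CommRing R] (x : R) {i c : ℕ} (hi : 0 < i) (N : ℕ) :
    ∏ m ∈ range ((2 * (i + c) + 1) * N),
      (if AvoidsResidues (i + c) i (m + 1) then 1 else 1 - x ^ (m + 1)) =
    ∏ m ∈ range N, ((1 - (x ^ i * x ^ (i + 2 * c + 1)) ^ (m + 1)) *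
        ((1 - x ^ i * (x ^ i * x ^ (i + 2 * c + 1)) ^ m) *
          (1 - x ^ (i + 2 * c + 1) * (x ^ i * x ^ (i + 2 * c + 1)) ^ m))) := by
  induction N with
  | zero => simp
  | succ N ih =>
    rw [mul_add, mul_one, prod_range_add, ih, prod_range_succ _ N]
    congr 1
    have : ∀ r ∈ range (2 * (i + c) + 1),
        (if AvoidsResidues (i + c) i ((2 * (i + c) + 1) * N + r + 1) then 1 else
          1 - x ^ ((2 * (i + c) + 1) * N + r + 1)) =
        if r ∈ ({2 * (i + c), i - 1, 2 * (i + c) - i} : Finset ℕ) then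
          1 - x ^ ((2 * (i + c) + 1) * N + r + 1) else 1 := by
      intro r hr
      rw [← ite_not]
      simp only [not_avoidsResidues_iff hi N r (mem_range.mp hr), mem_insert, mem_singleton]
    rw [prod_congr rfl this, prod_ite_mem, inter_eq_right.mpr, prod_insert, prod_insert,
      prod_singleton]
    · have e1 : (2 * (i + c) + 1) * N + 2 * (i + c) + 1 = (i + (i + 2 * c + 1)) * (N + 1) := by ring
      have e2 : (2 * (i + c) + 1) * N + (i - 1) + 1 = i + (i + (i + 2 * c + 1)) * N := by
        rw [add_assoc, Nat.sub_add_cancel hi]; ring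
      have e3 : (2 * (i + c) + 1) * N + (2 * (i + c) - i) + 1 =
          (i + 2 * c + 1) + (i + (i + 2 * c + 1)) * N := by
        rw [(by omega : 2 * (i + c) - i = i + 2 * c)]; ring
      rw [e1, e2, e3, ← pow_add, ← pow_mul, ← pow_mul, ← pow_add, ← pow_add]
    · rw [mem_singleton]; omega
    · rw [mem_insert, mem_singleton]; omega
    · intro r
      simp only [mem_insert, mem_singleton, mem_range]
      omega

/-- At `j = 0` the summand is that of the triple product with z = x^i and w = x^(2k+1-i). -/
theorem andrewsTerm_zero_shift {R : Type*} [CommRing R] (x : R) (i c n : ℕ) :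
    andrewsTerm x i c 0 n = (-1) ^ n * (x ^ i) ^ n.choose 2 *
      (x ^ (i + 2 * c + 1)) ^ (n + 1).choose 2 * (1 - (x ^ i) ^ (2 * n + 1)) := by
  have h := two_mul_choose_two_add n
  have h2 : (n + 1).choose 2 = n.choose 2 + n := by
    rw [Nat.choose_succ_succ' n 1, Nat.choose_one_right, add_comm]
  have e : 0 * (i + c) * n + (i + c) * n ^ 2 + (n + 1).choose 2 + c * n =
      i * n.choose 2 + (i + 2 * c + 1) * (n + 1).choose 2 := by
    rw [h2, sq, ← h]
    ring
  rw [andrewsTerm, e]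
  simp only [range_zero, prod_empty, mul_one, zero_add]
  ring

theorem X_pow_dvd_prod_mul_restricted_sub {i c : ℕ} (hi : 0 < i) (N : ℕ) :
    (X : ℤ⟦X⟧) ^ N ∣ (∏ m ∈ range N, (1 - X ^ (m + 1))) *
      (PowerSeries.mk fun n => (#(Nat.Partition.restricted n (AvoidsResidues (i + c) i)) : ℤ)) -
        ∑ n ∈ range N, andrewsTerm X i c 0 n := by
  have hN : N ≤ (2 * (i + c) + 1) * N := Nat.le_mul_of_pos_left N (by omega)
  have h1 := X_pow_dvd_restricted_mul_prod_sub_one (AvoidsResidues (i + c) i) hN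
  have h2 := (pow_dvd_pow (X : ℤ⟦X⟧) (Nat.le_succ N)).trans (pow_dvd_prod_range_sub X hN)
  have h3 := pow_dvd_tripleProduct_sub (R := ℤ⟦X⟧) (x := X) (z := X ^ i) (w := X ^ (i + 2 * c + 1))
    (pow_ne_zero _ X_ne_zero) (pow_ne_zero _ X_ne_zero)
    (fun n => by
      rw [isUnit_iff_constantCoeff, ← pow_add, ← pow_mul]
      simp)
    (dvd_pow_self _ hi.ne') (dvd_pow_self _ (by omega)) N
  rw [← prod_not_avoidsResidues X hi] at h3
  simp_rw [← andrewsTerm_zero_shift] at h3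
  have h4 : ∏ m ∈ range ((2 * (i + c) + 1) * N), (1 - (X : ℤ⟦X⟧) ^ (m + 1)) =
      (∏ m ∈ range ((2 * (i + c) + 1) * N),
        if AvoidsResidues (i + c) i (m + 1) then 1 - X ^ (m + 1) else 1) *
      ∏ m ∈ range ((2 * (i + c) + 1) * N),
        if AvoidsResidues (i + c) i (m + 1) then 1 else 1 - X ^ (m + 1) := by
    rw [← prod_mul_distrib]
    exact prod_congr rfl fun m _ => by split_ifs <;> simp
  rw [h4] at h2
  generalize ∏ m ∈ range ((2 * (i + c) + 1) * N),
    (if AvoidsResidues (i + c) i (m + 1) then 1 - (X : ℤ⟦X⟧) ^ (m + 1) else 1) = A at *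
  generalize ∏ m ∈ range ((2 * (i + c) + 1) * N),
    (if AvoidsResidues (i + c) i (m + 1) then 1 else 1 - (X : ℤ⟦X⟧) ^ (m + 1)) = B at *
  generalize (PowerSeries.mk fun n =>
    (#(Nat.Partition.restricted n (AvoidsResidues (i + c) i)) : ℤ)) = C at *
  -- Modulo X^N: (X)_N C ≡ ABC ≡ B, and B is congruent to the theta sum.
  have := dvd_add (dvd_sub (h1.mul_left B) (h2.mul_left C)) h3
  convert this using 1
  ring

theorem gordonSeries_eq_restricted {k i : ℕ} (hi : 0 < i) (hik : i ≤ k) :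
    gordonSeries k i 0 =
      PowerSeries.mk fun n => (#(Nat.Partition.restricted n (AvoidsResidues k i)) : ℤ) := by
  obtain ⟨c, rfl⟩ := Nat.exists_eq_add_of_le hik
  ext d
  have h1 := X_pow_dvd_prod_mul_gordonSeries_sub (d + 1) (Nat.succ_pos d) (d + 1) i c 0 rfl (by omega)
  have h2 := X_pow_dvd_prod_mul_restricted_sub (c := c) hi (d + 1)
  have h3 := dvd_sub h1 h2
  rw [sub_sub_sub_cancel_right, ← mul_sub, IsUnit.dvd_mul_left] at h3
  · have := X_pow_dvd_iff.mp h3 d (Nat.lt_succ_self d)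
    rwa [map_sub, sub_eq_zero] at this
  · refine (IsUnit.prod_iff).mpr fun m _ => ?_
    rw [isUnit_iff_constantCoeff]
    simp

/-- Multisets of positive integers with sum `n` and no element congruent to `0`, `i` or `-i`
modulo `2 * k + 1`. -/
def avoidingSet (k i n : ℕ) : Set (Multiset ℕ) :=
  {m | m.sum = n ∧ (∀ a ∈ m, 0 < a) ∧ ∀ a ∈ m, AvoidsResidues k i a}

theorem finite_avoidingSet (k i n : ℕ) : (avoidingSet k i n).Finite :=
  (finite_multiset_sum_eq n).subset fun _ h => ⟨h.1, h.2.1⟩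

theorem ncard_avoidingSet (k i n : ℕ) :
    (avoidingSet k i n).ncard = #(Nat.Partition.restricted n (AvoidsResidues k i)) := by
  have : avoidingSet k i n =
      Nat.Partition.parts '' (Nat.Partition.restricted n (AvoidsResidues k i) : Set n.Partition) := by
    ext m
    constructor
    · rintro ⟨h1, h2, h3⟩
      exact ⟨⟨m, fun {a} ha => h2 a ha, h1⟩, by simpa [Nat.Partition.restricted] using h3, rfl⟩
    · rintro ⟨p, hp, rfl⟩
      exact ⟨p.parts_sum, fun a ha => p.parts_pos ha, by
        simpa [Nat.Partition.restricted] using hp⟩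
  rw [this, Set.ncard_image_of_injective _ (fun p q h => Nat.Partition.ext h),
    Set.ncard_coe_finset]

/-- **Gordon's generalization of the Rogers-Ramanujan identities.** -/
theorem ncard_gordonSet_eq_ncard_avoidingSet {k i : ℕ} (hi : 0 < i) (hik : i ≤ k) (n : ℕ) :
    (gordonSet k i 0 n).ncard = (avoidingSet k i n).ncard := by
  have := congrArg (coeff n) (gordonSeries_eq_restricted hi hik)
  rw [gordonSeries, coeff_mk, coeff_mk, ← ncard_avoidingSet] at this
  exact_mod_cast this

end RogersRamanujanGordon

/-! ### Decomposing partitions along primitive rays -/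

namespace TotallyRealPartition

open RogersRamanujanGordon

variable {K : Type*} [Field K]

theorem IsTotallyPositive.natCast_mul {β : 𝓞 K} (h : IsTotallyPositive β) {n : ℕ} (hn : 0 < n) :
    IsTotallyPositive ((n : 𝓞 K) * β) := by
  intro φ
  have := h φ
  simp only [map_mul, map_natCast]
  positivity

/-- The multiple `n γ` for `n > 0` (and `γ` for `n = 0`). -/
def TotPos.mulNat (γ : TotPos K) (n : ℕ) : TotPos K :=
  if hn : 0 < n then ⟨(n : 𝓞 K) * γ, γ.2.natCast_mul hn⟩ else γ

theorem TotPos.coe_mulNat (γ : TotPos K) {n : ℕ} (hn : 0 < n) :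
    (γ.mulNat n : 𝓞 K) = n * (γ : 𝓞 K) := by
  simp [TotPos.mulNat, hn]

theorem isRadialDecomposition_mulNat {γ : TotPos K} (hγ : IsPrimitive γ) {n : ℕ} (hn : 0 < n) :
    IsRadialDecomposition (γ.mulNat n) n γ :=
  ⟨hn, hγ, γ.coe_mulNat hn⟩

theorem mulNat_one (γ : TotPos K) : γ.mulNat 1 = γ :=
  Subtype.ext (by simp [γ.coe_mulNat one_pos])

theorem Partition.ext_parts {δ : TotPos K} {p q : Partition δ} (h : p.parts = q.parts) : p = q := by
  cases p; cases q; congr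

theorem sum_map_mulNat (γ : TotPos K) {m : Multiset ℕ} (hm : ∀ n ∈ m, 0 < n) :
    ((m.map γ.mulNat).map fun a : TotPos K => (a : 𝓞 K)).sum = (m.sum : 𝓞 K) * γ := by
  induction m using Multiset.induction_on with
  | empty => simp
  | cons n m ih =>
    rw [Multiset.map_cons, Multiset.map_cons, Multiset.sum_cons, Multiset.sum_cons,
      ih fun a ha => hm a (Multiset.mem_cons_of_mem ha),
      γ.coe_mulNat (hm n (Multiset.mem_cons_self n m))]
    push_cast
    ring

theorem nsmul_le_of_le_count {δ : TotPos K} (p : Partition δ) (φ : K →+* ℝ) {a : TotPos K} {n : ℕ}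
    (h : Multiset.replicate n a ≤ p.parts) : n * φ ((a : 𝓞 K) : K) ≤ φ ((δ : 𝓞 K) : K) := by
  obtain ⟨m, hm⟩ := Multiset.le_iff_exists_add.mp h
  have key : ∀ m : Multiset (TotPos K), φ (((m.map fun a : TotPos K => (a : 𝓞 K)).sum : 𝓞 K) : K) =
      (m.map fun a : TotPos K => φ ((a : 𝓞 K) : K)).sum := by
    intro m
    induction m using Multiset.induction_on with
    | empty => simp
    | cons b m ih => simp [ih]
  rw [← p.sum_eq, key, hm, Multiset.map_add, Multiset.sum_add, Multiset.map_replicate,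
    Multiset.sum_replicate, nsmul_eq_mul]
  refine le_add_of_nonneg_right (Multiset.sum_nonneg fun x hx => ?_)
  obtain ⟨b, -, rfl⟩ := Multiset.mem_map.mp hx
  exact (b.2 φ).le

section Radial

variable [NumberField K] [IsTotallyReal K]

theorem scale_pos (a : TotPos K) : 0 < scale a := (radial_spec a).1

theorem isPrimitive_primitiveFactor (a : TotPos K) : IsPrimitive (primitiveFactor a) :=
  (radial_spec a).2.1

theorem scale_mulNat {γ : TotPos K} (hγ : IsPrimitive γ) {n : ℕ} (hn : 0 < n) :
    scale (γ.mulNat n) = n :=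
  (radial_unique (radial_spec _) (isRadialDecomposition_mulNat hγ hn)).1

theorem primitiveFactor_mulNat {γ : TotPos K} (hγ : IsPrimitive γ) {n : ℕ} (hn : 0 < n) :
    primitiveFactor (γ.mulNat n) = γ :=
  (radial_unique (radial_spec _) (isRadialDecomposition_mulNat hγ hn)).2

theorem mulNat_primitiveFactor_scale (a : TotPos K) :
    (primitiveFactor a).mulNat (scale a) = a :=
  Subtype.ext (((primitiveFactor a).coe_mulNat (scale_pos a)).trans (radial_spec a).2.2.symm)

open Classical in
/-- The scales of the elements of `l` with primitive factor `γ`. -/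
noncomputable def scalesAt (γ : TotPos K) (l : Multiset (TotPos K)) : Multiset ℕ :=
  (l.filter fun a => primitiveFactor a = γ).map scale

theorem mem_scalesAt {γ : TotPos K} {l : Multiset (TotPos K)} {n : ℕ} :
    n ∈ scalesAt γ l ↔ ∃ a ∈ l, primitiveFactor a = γ ∧ scale a = n := by
  simp [scalesAt, and_assoc]

theorem pos_of_mem_scalesAt {γ : TotPos K} {l : Multiset (TotPos K)} {n : ℕ}
    (h : n ∈ scalesAt γ l) : 0 < n := by
  obtain ⟨a, -, -, rfl⟩ := mem_scalesAt.mp h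
  exact scale_pos a

theorem eq_mulNat_iff {γ : TotPos K} (hγ : IsPrimitive γ) {n : ℕ} (hn : 0 < n) (a : TotPos K) :
    γ.mulNat n = a ↔ primitiveFactor a = γ ∧ scale a = n := by
  constructor
  · rintro rfl
    exact ⟨primitiveFactor_mulNat hγ hn, scale_mulNat hγ hn⟩
  · rintro ⟨rfl, rfl⟩
    exact mulNat_primitiveFactor_scale a

open Classical in
theorem count_scalesAt {γ : TotPos K} (hγ : IsPrimitive γ) (l : Multiset (TotPos K)) {n : ℕ}
    (hn : 0 < n) : (scalesAt γ l).count n = l.count (γ.mulNat n) := by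
  rw [scalesAt, Multiset.count_map, Multiset.filter_filter, Multiset.count,
    Multiset.countP_eq_card_filter]
  congr 1
  refine Multiset.filter_congr fun a _ => ?_
  rw [eq_mulNat_iff hγ hn, and_comm, eq_comm (a := n)]

/-- Every element is its scale times its primitive factor, so its multiplicity can be read on its
own ray. -/
theorem scalesAt_ext {l l' : Multiset (TotPos K)}
    (h : ∀ γ, IsPrimitive γ → scalesAt γ l = scalesAt γ l') : l = l' := by
  classical
  ext a
  have hp := isPrimitive_primitiveFactor a
  rw [← mulNat_primitiveFactor_scale a, ← count_scalesAt hp l (scale_pos a),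
    ← count_scalesAt hp l' (scale_pos a), h _ hp]

theorem scalesAt_add (γ : TotPos K) (l l' : Multiset (TotPos K)) :
    scalesAt γ (l + l') = scalesAt γ l + scalesAt γ l' := by
  simp [scalesAt]

theorem scalesAt_sum {ι : Type*} (γ : TotPos K) (s : Finset ι) (f : ι → Multiset (TotPos K)) :
    scalesAt γ (∑ x ∈ s, f x) = ∑ x ∈ s, scalesAt γ (f x) := by
  classical
  induction s using Finset.induction_on with
  | empty => simp [scalesAt]
  | insert x s hx ih => rw [Finset.sum_insert hx, Finset.sum_insert hx, scalesAt_add, ih]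

open Classical in
theorem scalesAt_map_mulNat {γ : TotPos K} (hγ : IsPrimitive γ) {m : Multiset ℕ}
    (hm : ∀ n ∈ m, 0 < n) : scalesAt γ (m.map γ.mulNat) = m := by
  rw [scalesAt, Multiset.filter_eq_self.mpr, Multiset.map_map]
  · conv_rhs => rw [← Multiset.map_id m]
    exact Multiset.map_congr rfl fun n hn => scale_mulNat hγ (hm n hn)
  · intro a ha
    obtain ⟨n, hn, rfl⟩ := Multiset.mem_map.mp ha
    exact primitiveFactor_mulNat hγ (hm n hn)

open Classical in
theorem scalesAt_map_mulNat_of_ne {γ γ' : TotPos K} (hγ' : IsPrimitive γ') (hne : γ' ≠ γ)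
    {m : Multiset ℕ} (hm : ∀ n ∈ m, 0 < n) : scalesAt γ (m.map γ'.mulNat) = 0 := by
  rw [scalesAt, Multiset.filter_eq_nil.mpr, Multiset.map_zero]
  intro a ha
  obtain ⟨n, hn, rfl⟩ := Multiset.mem_map.mp ha
  rwa [primitiveFactor_mulNat hγ' (hm n hn)]

open Classical in
/-- The primitive factors of the elements of `l`. -/
noncomputable def primitiveFactors (l : Multiset (TotPos K)) : Finset (TotPos K) :=
  (l.map primitiveFactor).toFinset

theorem mem_primitiveFactors {l : Multiset (TotPos K)} {γ : TotPos K} :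
    γ ∈ primitiveFactors l ↔ ∃ a ∈ l, primitiveFactor a = γ := by
  simp [primitiveFactors]

theorem scalesAt_eq_zero_of_notMem {l : Multiset (TotPos K)} {γ : TotPos K}
    (h : γ ∉ primitiveFactors l) : scalesAt γ l = 0 :=
  Multiset.eq_zero_of_forall_notMem fun _ hn =>
    let ⟨a, ha, hγ, _⟩ := mem_scalesAt.mp hn
    h (mem_primitiveFactors.mpr ⟨a, ha, hγ⟩)

/-- Replace, for each primitive factor `γ`, the multiset of scales at `γ` by its image under
`e`. -/
noncomputable def mapScales (e : Multiset ℕ → Multiset ℕ) (l : Multiset (TotPos K)) :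
    Multiset (TotPos K) :=
  ∑ γ ∈ primitiveFactors l, (e (scalesAt γ l)).map γ.mulNat

theorem isPrimitive_of_mem_primitiveFactors {l : Multiset (TotPos K)} {γ : TotPos K}
    (h : γ ∈ primitiveFactors l) : IsPrimitive γ := by
  obtain ⟨a, -, rfl⟩ := mem_primitiveFactors.mp h
  exact isPrimitive_primitiveFactor a

/-- Distinct rays do not interact. On a ray that `l` does not meet, preservation of the sum together
with positivity forces the image under `e` to be empty, so nothing is lost by summing only over
`primitiveFactors l`. -/
theorem scalesAt_mapScales {e : Multiset ℕ → Multiset ℕ} {l : Multiset (TotPos K)}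
    (hpos : ∀ γ, IsPrimitive γ → ∀ n ∈ e (scalesAt γ l), 0 < n)
    (hsum : ∀ γ, IsPrimitive γ → (e (scalesAt γ l)).sum = (scalesAt γ l).sum)
    {γ : TotPos K} (hγ : IsPrimitive γ) :
    scalesAt γ (mapScales e l) = e (scalesAt γ l) := by
  rw [mapScales, scalesAt_sum]
  by_cases h : γ ∈ primitiveFactors l
  · rw [Finset.sum_eq_single_of_mem γ h, scalesAt_map_mulNat hγ (hpos γ hγ)]
    intro γ' h' hne
    have hγ' := isPrimitive_of_mem_primitiveFactors h'
    exact scalesAt_map_mulNat_of_ne hγ' hne (hpos _ hγ')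
  · have he : e (scalesAt γ l) = 0 := by
      refine Multiset.eq_zero_of_forall_notMem fun n hn => ?_
      have h1 := Multiset.le_sum_of_mem hn
      have h2 := hpos γ hγ n hn
      rw [hsum γ hγ, scalesAt_eq_zero_of_notMem h, Multiset.sum_zero] at h1
      omega
    rw [he]
    refine Finset.sum_eq_zero fun γ' h' => ?_
    have hγ' := isPrimitive_of_mem_primitiveFactors h'
    exact scalesAt_map_mulNat_of_ne hγ' (ne_of_mem_of_not_mem h' h) (hpos _ hγ')

theorem mapScales_id (l : Multiset (TotPos K)) : mapScales id l = l :=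
  scalesAt_ext fun _ hγ =>
    scalesAt_mapScales (fun _ _ _ hn => pos_of_mem_scalesAt hn) (fun _ _ => rfl) hγ

theorem sum_mapScales {e : Multiset ℕ → Multiset ℕ} {l : Multiset (TotPos K)}
    (hpos : ∀ γ, IsPrimitive γ → ∀ n ∈ e (scalesAt γ l), 0 < n) :
    ((mapScales e l).map fun a : TotPos K => (a : 𝓞 K)).sum =
      ∑ γ ∈ primitiveFactors l, ((e (scalesAt γ l)).sum : 𝓞 K) * γ := by
  rw [mapScales, ← Multiset.coe_mapAddMonoidHom, map_sum, ← Multiset.coe_sumAddMonoidHom, map_sum]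
  exact Finset.sum_congr rfl fun γ hγ =>
    sum_map_mulNat γ (hpos γ (isPrimitive_of_mem_primitiveFactors hγ))

theorem sum_mapScales_eq {e : Multiset ℕ → Multiset ℕ} {l : Multiset (TotPos K)}
    (hpos : ∀ γ, IsPrimitive γ → ∀ n ∈ e (scalesAt γ l), 0 < n)
    (hsum : ∀ γ, IsPrimitive γ → (e (scalesAt γ l)).sum = (scalesAt γ l).sum) :
    ((mapScales e l).map fun a : TotPos K => (a : 𝓞 K)).sum =
      (l.map fun a : TotPos K => (a : 𝓞 K)).sum := by
  rw [sum_mapScales hpos]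
  conv_rhs => rw [← mapScales_id l, sum_mapScales (fun _ _ _ hn => pos_of_mem_scalesAt hn)]
  exact Finset.sum_congr rfl fun γ hγ => by
    rw [hsum γ (isPrimitive_of_mem_primitiveFactors hγ), id]

open Classical in
theorem countP_scale_sub (γ : TotPos K) (l : Multiset (TotPos K)) {n : ℕ} (hn : 0 < n) :
    l.countP (fun b => primitiveFactor b = γ ∧ ((n : ℤ) - scale b = 0 ∨ (n : ℤ) - scale b = 1)) =
      (scalesAt γ l).count (n - 1) + (scalesAt γ l).count n := by
  induction l using Multiset.induction_on with
  | empty => simp [scalesAt]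
  | cons b l ih =>
    by_cases hb : primitiveFactor b = γ
    · have h1 : scalesAt γ (b ::ₘ l) = scale b ::ₘ scalesAt γ l := by simp [scalesAt, hb]
      rw [h1, Multiset.countP_cons, ih, Multiset.count_cons, Multiset.count_cons]
      simp only [hb, true_and]
      split_ifs <;> omega
    · have h1 : scalesAt γ (b ::ₘ l) = scalesAt γ l := by simp [scalesAt, hb]
      rw [h1, Multiset.countP_cons, ih, if_neg fun h => hb h.1, add_zero]

/-- `IsGordon` tests a pair of consecutive scales only when the larger one occurs. If only the
smaller one `s` occurs, the test at `s` already bounds its multiplicity; if neither does, `0 < k`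
suffices. -/
theorem isGordon_iff {k i : ℕ} (hk : 0 < k) (hi : 0 < i) {δ : TotPos K} (p : Partition δ) :
    IsGordon k i p ↔ ∀ γ, IsPrimitive γ →
      scalesAt γ p.parts ∈ gordonSet k i 0 (scalesAt γ p.parts).sum := by
  constructor
  · rintro ⟨h1, h2⟩ γ hγ
    have h1' : ∀ n ∈ scalesAt γ p.parts,
        (scalesAt γ p.parts).count (n - 1) + (scalesAt γ p.parts).count n ≤ k - 1 := by
      intro n hn
      obtain ⟨a, ha, rfl, rfl⟩ := mem_scalesAt.mp hn
      rw [← countP_scale_sub _ _ (scale_pos a)]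
      exact h1 a ha
    refine ⟨rfl, fun n hn => pos_of_mem_scalesAt hn, ?_, fun s => ?_⟩
    · rw [zero_add, count_scalesAt hγ _ one_pos, mulNat_one]
      exact Nat.lt_of_le_sub_one hi (h2 γ hγ)
    · by_cases hs : s + 1 ∈ scalesAt γ p.parts
      · have := h1' _ hs
        rw [Nat.add_sub_cancel] at this
        omega
      · rw [Multiset.count_eq_zero.mpr hs]
        by_cases hs' : s ∈ scalesAt γ p.parts
        · have := h1' _ hs'
          omega
        · rw [Multiset.count_eq_zero.mpr hs']
          omega
  · intro h
    constructor
    · intro a ha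
      rw [countP_scale_sub _ _ (scale_pos a)]
      have h1 := (h _ (isPrimitive_primitiveFactor a)).2.2.2 (scale a - 1)
      rw [Nat.sub_add_cancel (scale_pos a)] at h1
      omega
    · intro γ hγ
      have h1 := (h γ hγ).2.2.1
      rw [zero_add, count_scalesAt hγ _ one_pos, mulNat_one] at h1
      exact Nat.le_sub_one_of_lt h1

theorem hasScalesAvoiding_iff {k i : ℕ} {δ : TotPos K} (p : Partition δ) :
    HasScalesAvoiding k i p ↔ ∀ γ, IsPrimitive γ →
      scalesAt γ p.parts ∈ avoidingSet k i (scalesAt γ p.parts).sum := by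
  constructor
  · intro h γ _
    refine ⟨rfl, fun n hn => pos_of_mem_scalesAt hn, fun n hn => ?_⟩
    obtain ⟨a, ha, -, rfl⟩ := mem_scalesAt.mp hn
    exact h a ha
  · intro h a ha
    exact (h _ (isPrimitive_primitiveFactor a)).2.2 _ (mem_scalesAt.mpr ⟨a, ha, rfl, rfl⟩)

/-! ### Finiteness and transfer of Gordon's theorem -/

theorem finite_setOf_forall_le (δ : TotPos K) :
    {a : TotPos K | ∀ φ : K →+* ℝ, φ ((a : 𝓞 K) : K) ≤ φ ((δ : 𝓞 K) : K)}.Finite := by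
  -- The sum serves as one constant bounding every conjugate of `δ`, hence of `a`.
  have hfin := Embeddings.finite_of_norm_le K ℂ (∑ ψ : K →+* ℂ, ‖ψ ((δ : 𝓞 K) : K)‖)
  refine (hfin.preimage (f := fun a : TotPos K => ((a : 𝓞 K) : K)) ?_).subset ?_
  · intro a _ b _ h
    exact Subtype.ext (RingOfIntegers.ext h)
  · intro a ha
    refine ⟨RingOfIntegers.isIntegral_coe _, fun ψ => ?_⟩
    refine le_trans ?_ (Finset.single_le_sum (f := fun ψ : K →+* ℂ => ‖ψ ((δ : 𝓞 K) : K)‖)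
      (fun _ _ => norm_nonneg _) (Finset.mem_univ ψ))
    have hψ := IsTotallyReal.complexEmbedding_isReal ψ
    rw [← hψ.coe_embedding_apply, ← hψ.coe_embedding_apply, Complex.norm_real, Complex.norm_real,
      Real.norm_of_nonneg (a.2 _).le, Real.norm_of_nonneg (δ.2 _).le]
    exact ha _

/-- By positivity each part is bounded by `δ` at every real embedding, so finitely many parts are
possible, and a single embedding bounds their multiplicities. All partitions thus lie below one
multiset. -/
theorem finite_partition (δ : TotPos K) : Finite (Partition δ) := by
  classical
  obtain ⟨v⟩ : Nonempty (InfinitePlace K) := inferInstance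
  let φ := InfinitePlace.embedding_of_isReal (IsTotallyReal.isReal v)
  let S := (finite_setOf_forall_le δ).toFinset
  let bound : Multiset (TotPos K) :=
    ∑ a ∈ S, Multiset.replicate ⌊φ ((δ : 𝓞 K) : K) / φ ((a : 𝓞 K) : K)⌋₊ a
  have hle (p : Partition δ) : p.parts ≤ bound := by
    rw [Multiset.le_iff_count]
    intro a
    by_cases ha : a ∈ p.parts
    · have haS : a ∈ S := by
        simp only [S, Set.Finite.mem_toFinset]
        intro φ
        simpa using nsmul_le_of_le_count p φ (n := 1) (a := a) (by simpa using ha)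
      simp only [bound]
      rw [Multiset.count_sum']
      refine le_trans ?_ (Finset.single_le_sum (fun _ _ => Nat.zero_le _) haS)
      rw [Multiset.count_replicate_self]
      refine Nat.le_floor ?_
      rw [le_div_iff₀ (a.2 φ)]
      exact nsmul_le_of_le_count p φ (Multiset.le_count_iff_replicate_le.mp le_rfl)
    · rw [Multiset.count_eq_zero.mpr ha]
      exact Nat.zero_le _
  have : Finite (Set.Iic bound) := (Set.finite_Iic bound).to_subtype
  exact Finite.of_injective (fun p : Partition δ => (⟨p.parts, hle p⟩ : Set.Iic bound))
    fun p q h => Partition.ext_parts (congrArg Subtype.val h)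

/-- Families of multisets, graded by their sum, of equal sizes in each degree give equally many
partitions of `δ` whose scales at every primitive element belong to the family. -/
theorem ncard_eq_of_scalesAt {A B : ℕ → Set (Multiset ℕ)} (hA : ∀ n, (A n).Finite)
    (hB : ∀ n, (B n).Finite) (hAB : ∀ n, (A n).ncard = (B n).ncard)
    (hAs : ∀ n, ∀ m ∈ A n, m.sum = n ∧ ∀ a ∈ m, 0 < a)
    (hBs : ∀ n, ∀ m ∈ B n, m.sum = n ∧ ∀ a ∈ m, 0 < a) (δ : TotPos K) :
    {p : Partition δ | ∀ γ, IsPrimitive γ →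
      scalesAt γ p.parts ∈ A (scalesAt γ p.parts).sum}.ncard =
    {p : Partition δ | ∀ γ, IsPrimitive γ →
      scalesAt γ p.parts ∈ B (scalesAt γ p.parts).sum}.ncard := by
  -- One bijection is fixed per degree and applied at `m.sum`. As it preserves the sum, its inverse
  -- is later taken in the same degree.
  choose f hf using fun n => (hA n).exists_bijOn_of_encard_eq
    (by rw [← (hA n).cast_ncard_eq, ← (hB n).cast_ncard_eq, hAB n] : (A n).encard = (B n).encard)
  let g := fun n => Function.invFunOn (f n) (A n)
  have hg (n : ℕ) : Set.InvOn (g n) (f n) (A n) (B n) := (hf n).invOn_invFunOn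
  have hgm (n : ℕ) : Set.MapsTo (g n) (B n) (A n) := (hf n).surjOn.mapsTo_invFunOn
  have hfs {m : Multiset ℕ} (hm : m ∈ A m.sum) := hBs _ _ ((hf m.sum).mapsTo hm)
  have hgs {m : Multiset ℕ} (hm : m ∈ B m.sum) := hAs _ _ (hgm m.sum hm)
  have scF {l : Multiset (TotPos K)} (h : ∀ γ, IsPrimitive γ → scalesAt γ l ∈ A (scalesAt γ l).sum)
      {γ : TotPos K} (hγ : IsPrimitive γ) :=
    scalesAt_mapScales (e := fun m => f m.sum m) (fun γ hγ => (hfs (h γ hγ)).2)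
      (fun γ hγ => (hfs (h γ hγ)).1) hγ
  have scG {l : Multiset (TotPos K)} (h : ∀ γ, IsPrimitive γ → scalesAt γ l ∈ B (scalesAt γ l).sum)
      {γ : TotPos K} (hγ : IsPrimitive γ) :=
    scalesAt_mapScales (e := fun m => g m.sum m) (fun γ hγ => (hgs (h γ hγ)).2)
      (fun γ hγ => (hgs (h γ hγ)).1) hγ
  have memF {l : Multiset (TotPos K)} (h : ∀ γ, IsPrimitive γ → scalesAt γ l ∈ A (scalesAt γ l).sum)
      (γ : TotPos K) (hγ : IsPrimitive γ) : scalesAt γ (mapScales (fun m => f m.sum m) l) ∈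
        B (scalesAt γ (mapScales (fun m => f m.sum m) l)).sum := by
    rw [scF h hγ, (hfs (h γ hγ)).1]
    exact (hf _).mapsTo (h γ hγ)
  have memG {l : Multiset (TotPos K)} (h : ∀ γ, IsPrimitive γ → scalesAt γ l ∈ B (scalesAt γ l).sum)
      (γ : TotPos K) (hγ : IsPrimitive γ) : scalesAt γ (mapScales (fun m => g m.sum m) l) ∈
        A (scalesAt γ (mapScales (fun m => g m.sum m) l)).sum := by
    rw [scG h hγ, (hgs (h γ hγ)).1]
    exact hgm _ (h γ hγ)
  have GF {l : Multiset (TotPos K)}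
      (h : ∀ γ, IsPrimitive γ → scalesAt γ l ∈ A (scalesAt γ l).sum) :
      mapScales (fun m => g m.sum m) (mapScales (fun m => f m.sum m) l) = l :=
    scalesAt_ext fun γ hγ => by
      rw [scG (memF h) hγ, scF h hγ, (hfs (h γ hγ)).1]
      exact (hg _).1 (h γ hγ)
  have FG {l : Multiset (TotPos K)}
      (h : ∀ γ, IsPrimitive γ → scalesAt γ l ∈ B (scalesAt γ l).sum) :
      mapScales (fun m => f m.sum m) (mapScales (fun m => g m.sum m) l) = l :=
    scalesAt_ext fun γ hγ => by
      rw [scF (memG h) hγ, scG h hγ, (hgs (h γ hγ)).1]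
      exact (hg _).2 (h γ hγ)
  refine Set.ncard_congr (fun p hp => ⟨mapScales (fun m => f m.sum m) p.parts,
      (sum_mapScales_eq (fun γ hγ => (hfs (hp γ hγ)).2) fun γ hγ => (hfs (hp γ hγ)).1).trans
        p.sum_eq⟩) ?_ ?_ ?_
  · intro p hp
    exact memF hp
  · intro p q hp hq h
    have h' : mapScales (fun m => f m.sum m) p.parts = mapScales (fun m => f m.sum m) q.parts :=
      congrArg Partition.parts h
    exact Partition.ext_parts (by rw [← GF hp, ← GF hq, h'])
  · intro q hq
    exact ⟨⟨mapScales (fun m => g m.sum m) q.parts,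
      (sum_mapScales_eq (fun γ hγ => (hgs (hq γ hγ)).2) fun γ hγ => (hgs (hq γ hγ)).1).trans
        q.sum_eq⟩, memG hq, Partition.ext_parts (FG hq)⟩

end Radial

end TotallyRealPartition

theorem mainTheorem4 {K : Type*} [Field K] [NumberField K] [NumberField.IsTotallyReal K]
    (k i : ℕ) (hk : 2 ≤ k) (hi : 1 ≤ i) (hik : i ≤ k) (δ : TotallyRealPartition.TotPos K) :
    {l : TotallyRealPartition.Partition δ | TotallyRealPartition.IsGordon k i l}.Finite ∧
    {l : TotallyRealPartition.Partition δ | TotallyRealPartition.HasScalesAvoiding k i l}.Finite ∧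
    {l : TotallyRealPartition.Partition δ | TotallyRealPartition.IsGordon k i l}.ncard =
      {l : TotallyRealPartition.Partition δ |
        TotallyRealPartition.HasScalesAvoiding k i l}.ncard := by
  have := TotallyRealPartition.finite_partition δ
  refine ⟨Set.toFinite _, Set.toFinite _, ?_⟩
  simp only [TotallyRealPartition.isGordon_iff (by omega : 0 < k) hi,
    TotallyRealPartition.hasScalesAvoiding_iff]
  exact TotallyRealPartition.ncard_eq_of_scalesAt
    (fun n => RogersRamanujanGordon.finite_gordonSet k i 0 n)
    (fun n => RogersRamanujanGordon.finite_avoidingSet k i n)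
    (fun n => RogersRamanujanGordon.ncard_gordonSet_eq_ncard_avoidingSet hi hik n)
    (fun n m hm => ⟨hm.1, hm.2.1⟩) (fun n m hm => ⟨hm.1, hm.2.1⟩) δ
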